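/- A digital image is a set of points with a symmetric antireflexive adjacency relation, i.e. a simple graph. A map $f\colon X\to Y$ of images is continuous if $f(x),f(x')$ are adjacent or equal whenever $x,x'$ are adjacent. Continuous maps $f,g\colon X\to Y$ are homotopic, $f\simeq g$, if for some $k\ge 0$ there is $H\colon X\times\{0,\dots,k\}\to Y$ with $H(\cdot,0)=f$ and $H(\cdot,k)=g$, continuous in each variable separately (consecutive integers being adjacent). Images $X,Y$ are homotopy equivalent if there are continuous $f\colon X\to Y$ and $g\colon Y\to X$ with $f\circ g\simeq \mathrm{id}_Y$ and $g\circ f\simeq\mathrm{id}_X$. A finite image is irreducible if it is not homotopy equivalent to an image with fewer points. Write $C_m$ for the cycle on $m$ points, $N(x)$ for the set consisting of $x$ and all points adjacent to $x$, and $P$ for the image with points $x_0,x_1,x_2,x_3,x_4,x_4'$ whose adjacencies are $x_0x_1,\ x_1x_2,\ x_2x_3,\ x_3x_4,\ x_4x_0,\ x_3x_4',\ x_4'x_0$. **Theorem.** Let $X$ be a connected digital image of $6$ points. 1. If $X$ is irreducible, then $X$ is homotopy equivalent to $C_6$, and is in fact isomorphic to $C_6$. 2. The following are equivalent: (a) there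 is no complete subgraph $S$ of $X$ such that every point of $X$ lies in $S$ or is adjacent to a point of $S$, and there are no two distinct points $x,y$ of $X$ with $N(x)\subseteq N(y)$; (b) $X$ is isomorphic to $C_6$ or to $P$. 3. The image $P$ is homotopy equivalent to $C_5$. -/

import Mathlib

universe u v

namespace DigitalImage

/-! A digital image is a set of points with a symmetric antireflexive adjacency relation,
that is, a `SimpleGraph`. -/

/-- A function between digital images is continuous when it sends adjacent points to
adjacent or equal points. -/
def IsContinuous {V : Type u} {W : Type v} (G : SimpleGraph V) (H : SimpleGraph W)
    (f : V → W) : Prop :=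
  ∀ x y : V, G.Adj x y → H.Adj (f x) (f y) ∨ f x = f y

/-- Two continuous maps are homotopic when they are joined by a map `V × [0, k] → W` which is
continuous in each variable separately. The digital interval `[0, k]` is the path graph on its
`k + 1` points (consecutive integers are adjacent). -/
def Homotopic {V : Type u} {W : Type v} (G : SimpleGraph V) (H : SimpleGraph W)
    (f g : V → W) : Prop :=
  IsContinuous G H f ∧ IsContinuous G H g ∧
    ∃ (k : ℕ) (F : V → Fin (k + 1) → W),
      (∀ x, F x 0 = f x) ∧ (∀ x, F x (Fin.last k) = g x) ∧
      (∀ t, IsContinuous G H (fun x => F x t)) ∧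
      (∀ x, IsContinuous (SimpleGraph.pathGraph (k + 1)) H (F x))

/-- Homotopy equivalence of digital images. -/
def HomotopyEquivalent {V : Type u} {W : Type v} (G : SimpleGraph V) (H : SimpleGraph W) :
    Prop :=
  ∃ (f : V → W) (g : W → V), IsContinuous G H f ∧ IsContinuous H G g ∧
    Homotopic H H (f ∘ g) id ∧ Homotopic G G (g ∘ f) id

/-- A finite image is reducible when it is homotopy equivalent to an image of fewer points. -/
def IsReducible {V : Type u} [Finite V] (G : SimpleGraph V) : Prop :=
  ∃ (W : Type u) (_ : Finite W) (H : SimpleGraph W),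
    Nat.card W < Nat.card V ∧ HomotopyEquivalent G H

/-- A finite image is irreducible when it is not reducible. -/
def IsIrreducible {V : Type u} [Finite V] (G : SimpleGraph V) : Prop :=
  ¬ IsReducible G

/-- The closed neighborhood `N(x)`: the point `x` and all points adjacent to it. -/
def closedNbhd {V : Type u} (G : SimpleGraph V) (x : V) : Set V :=
  {y | y = x ∨ G.Adj y x}

/-- Some complete subgraph `S` dominates the image: every point lies in `S` or is adjacent to a
point of `S`. -/
def HasDominatingClique {V : Type u} (G : SimpleGraph V) : Prop :=
  ∃ S : Set V, G.IsClique S ∧ ∀ x, ∃ s ∈ S, x = s ∨ G.Adj x s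

/-- Some closed neighborhood is contained in the closed neighborhood of a different point. -/
def HasNestedNbhds {V : Type u} (G : SimpleGraph V) : Prop :=
  ∃ x y : V, x ≠ y ∧ closedNbhd G x ⊆ closedNbhd G y

/-- The pentagon with one doubled vertex: a pentagon `0, 1, 2, 3, 4` and a sixth point `5`
which is adjacent exactly to `3` and `0`, the two neighbors of `4`. -/
def doubledPentagon : SimpleGraph (Fin 6) :=
  SimpleGraph.fromEdgeSet {s(0, 1), s(1, 2), s(2, 3), s(3, 4), s(4, 0), s(3, 5), s(5, 0)}

end DigitalImage

/-!
A continuous self-map moving each point to an adjacent or equal point is homotopic to the identity,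
and so are its iterates; hence a retraction whose idempotent is such an iterate is a homotopy
equivalence (`homotopyEquivalent_of_retraction`). This gives every equivalence needed. If `S` is a
dominating clique, moving all points into `S` and then collapsing `S` contracts the image. If
`N(x) ⊆ N(y)`, the point `x` can be pushed onto `y`. In the doubled pentagon, turning the pentagon
by one step, with both copies of the doubled point moving together, merges the two copies, and after
five steps the pentagon is back in place. So the doubled pentagon is equivalent to `C₅`, although it
has neither a dominating clique nor nested neighborhoods.

It remains to classify the connected six-point images with neither. Every point has at least two
neighbors. If none has three, the image is a cycle. If `v` has neighbors `a, b, c`, it has no fourth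
one, each of `a, b, c` is joined to exactly one of the two remaining points `d, e`, and these are
not all joined to the same one. Say `d` is joined to `a, b` and `e` to `c`; then `d, e` are adjacent
and any edge among `a, b, c` would produce a dominating edge or nested neighborhoods, which leaves
the doubled pentagon (`iso_cycleGraph_six_or_doubledPentagon`).
-/

namespace DigitalImage

/-! ### Homotopies and homotopy equivalences -/

section Homotopy

variable {V : Type u} {W : Type v} {G : SimpleGraph V} {H : SimpleGraph W}

theorem isContinuous_id : IsContinuous G G id := fun _ _ h => Or.inl h

theorem IsContinuous.comp {X : Type*} {K : SimpleGraph X} {g : W → X} {f : V → W}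
    (hg : IsContinuous H K g) (hf : IsContinuous G H f) : IsContinuous G K (g ∘ f) := by
  intro x y hxy
  rcases hf x y hxy with h | h
  · exact hg _ _ h
  · exact Or.inr (congrArg g h)

theorem IsContinuous.iterate {h : V → V} (hh : IsContinuous G G h) (n : ℕ) :
    IsContinuous G G h^[n] := by
  induction n with
  | zero => exact isContinuous_id
  | succ n ih => exact ih.comp hh

theorem isContinuous_iso (e : G ≃g H) : IsContinuous G H e :=
  fun _ _ h => Or.inl (e.map_adj_iff.2 h)

/-- A continuous self-map moving every point to an adjacent or equal point has all its iterates
homotopic to the identity: the homotopy runs down through the iterates. -/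
theorem homotopic_iterate_id {h : V → V} (hh : IsContinuous G G h)
    (hnear : ∀ x, G.Adj x (h x) ∨ x = h x) (n : ℕ) : Homotopic G G h^[n] id := by
  refine ⟨hh.iterate n, isContinuous_id, n, fun x t => h^[n - t] x, fun x => by simp,
    fun x => by simp, fun t => hh.iterate _, fun x s t hst => ?_⟩
  have step : ∀ m : ℕ, G.Adj (h^[m] x) (h^[m + 1] x) ∨ h^[m] x = h^[m + 1] x := fun m => by
    rw [Function.iterate_succ_apply']
    exact hnear _
  have hs := s.2
  have ht := t.2
  rw [SimpleGraph.pathGraph_adj] at hst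
  rcases hst with hst | hst
  · have : n - (s : ℕ) = n - t + 1 := by omega
    simp only [this]
    exact (step _).imp SimpleGraph.Adj.symm Eq.symm
  · have : n - (t : ℕ) = n - s + 1 := by omega
    simp only [this]
    exact step _

theorem homotopic_id_id : Homotopic G G id id :=
  homotopic_iterate_id (h := id) isContinuous_id (fun _ => Or.inr rfl) 0

/-- A retraction onto `H` is a homotopy equivalence as soon as the corresponding idempotent of `G`
is an iterate of a continuous map moving every point to an adjacent or equal point. -/
theorem homotopyEquivalent_of_retraction {f : V → W} {g : W → V} {h : V → V} (n : ℕ)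
    (hf : IsContinuous G H f) (hg : IsContinuous H G g) (hh : IsContinuous G G h)
    (hnear : ∀ x, G.Adj x (h x) ∨ x = h x) (hfg : f ∘ g = id) (hgf : g ∘ f = h^[n]) :
    HomotopyEquivalent G H := by
  refine ⟨f, g, hf, hg, ?_, ?_⟩
  · rw [hfg]
    exact homotopic_id_id
  · rw [hgf]
    exact homotopic_iterate_id hh hnear n

theorem homotopyEquivalent_of_iso (e : G ≃g H) : HomotopyEquivalent G H :=
  homotopyEquivalent_of_retraction (h := id) 0 (isContinuous_iso e) (isContinuous_iso e.symm)
    isContinuous_id (fun _ => Or.inr rfl) (funext e.apply_symm_apply) (funext e.symm_apply_apply)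

theorem Homotopic.conj {V' : Type*} {G' : SimpleGraph V'} {f : V → V} (hf : Homotopic G G f id)
    (e : G ≃g G') : Homotopic G' G' (e ∘ f ∘ e.symm) id := by
  obtain ⟨hfc, -, k, F, h0, hk, hx, ht⟩ := hf
  have he := isContinuous_iso e
  have he' := isContinuous_iso e.symm
  exact ⟨he.comp (hfc.comp he'), isContinuous_id, k, fun x t => e (F (e.symm x) t),
    fun x => congrArg e (h0 _), fun x => by simp [hk], fun t => he.comp ((hx t).comp he'),
    fun x => he.comp (ht _)⟩

theorem HomotopyEquivalent.congr {V' W' : Type*} {G' : SimpleGraph V'} {H' : SimpleGraph W'}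
    (hGH : HomotopyEquivalent G H) (e : G ≃g G') (e' : H ≃g H') : HomotopyEquivalent G' H' := by
  obtain ⟨f, g, hf, hg, hfg, hgf⟩ := hGH
  refine ⟨e' ∘ f ∘ e.symm, e ∘ g ∘ e'.symm, (isContinuous_iso e').comp
    (hf.comp (isContinuous_iso e.symm)), (isContinuous_iso e).comp
    (hg.comp (isContinuous_iso e'.symm)), ?_, ?_⟩
  · convert hfg.conj e' using 1
    ext x
    simp
  · convert hgf.conj e using 1
    ext x
    simp

end Homotopy

/-! ### Reductions by dominating cliques and nested neighborhoods -/

section Reducible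

variable {V : Type u} {G : SimpleGraph V}

/-- An image with a dominating clique `S` is contractible. Move the points outside `S` to neighbors
in `S`, and collapse `S` to one of its points: the square of this map is constant. -/
theorem HasDominatingClique.homotopyEquivalent_punit [Nonempty V] (hG : HasDominatingClique G) :
    HomotopyEquivalent G (⊥ : SimpleGraph PUnit.{v + 1}) := by
  classical
  obtain ⟨S, hS, hdom⟩ := hG
  choose p hpS hp using hdom
  obtain ⟨s, hs⟩ : S.Nonempty := ⟨_, hpS (Classical.arbitrary V)⟩
  have near : ∀ {x y}, x ∈ S → y ∈ S → G.Adj x y ∨ x = y := fun hx hy =>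
    or_iff_not_imp_right.2 (hS hx hy)
  let h : V → V := fun x => if x ∈ S then s else p x
  have hhS : ∀ x, h x ∈ S := fun x => by
    by_cases hx : x ∈ S <;> simp [h, hx, hs, hpS]
  refine homotopyEquivalent_of_retraction (f := fun _ => PUnit.unit) (g := fun _ => s) (h := h) 2
    (fun _ _ _ => Or.inr rfl) (fun _ _ _ => Or.inr rfl) (fun x y _ => near (hhS x) (hhS y))
    (fun x => ?_) rfl (funext fun x => ?_)
  · by_cases hx : x ∈ S
    · simpa [h, hx] using near hx hs
    · simpa [h, hx] using (hp x).symm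
  · change s = h (h x)
    exact (if_pos (hhS x)).symm

theorem HasDominatingClique.isReducible [Finite V] (hV : 1 < Nat.card V)
    (hG : HasDominatingClique G) : IsReducible G := by
  have : Nonempty V := (Nat.card_pos_iff.1 (by omega)).1
  exact ⟨PUnit, inferInstance, ⊥, by simpa using hV, hG.homotopyEquivalent_punit⟩

/-- If `N(x) ⊆ N(y)` then pushing `x` onto `y` deletes the point `x`. -/
theorem HasNestedNbhds.isReducible [Finite V] (hG : HasNestedNbhds G) : IsReducible G := by
  classical
  obtain ⟨x, y, hxy, hsub⟩ := hG
  have hadj : G.Adj x y := (hsub (Or.inl rfl : x ∈ closedNbhd G x)).resolve_left hxy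
  have hN : ∀ z, G.Adj z x → z = y ∨ G.Adj z y := fun z hz => hsub (Or.inr hz)
  let f : V → {z // z ≠ x} := fun z => if hz : z = x then ⟨y, hxy.symm⟩ else ⟨z, hz⟩
  have hfx : ((f x : {z // z ≠ x}) : V) = y := by simp [f]
  have hfz : ∀ z, z ≠ x → ((f z : {z // z ≠ x}) : V) = z := fun z hz => by simp [f, hz]
  have hval : IsContinuous (G.comap Subtype.val) G (Subtype.val : {z // z ≠ x} → V) :=
    fun _ _ h => Or.inl h
  have hf : IsContinuous G (G.comap (Subtype.val : {z // z ≠ x} → V)) f := by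
    intro z w hzw
    rw [SimpleGraph.comap_adj, Subtype.ext_iff]
    by_cases hz : z = x
    · subst hz
      rw [hfx, hfz w hzw.ne']
      exact ((hN w hzw.symm).symm).imp SimpleGraph.Adj.symm Eq.symm
    · by_cases hw : w = x
      · subst hw
        rw [hfx, hfz z hz]
        exact (hN z hzw).symm
      · rw [hfz z hz, hfz w hw]
        exact Or.inl hzw
  refine ⟨{z // z ≠ x}, inferInstance, G.comap Subtype.val, ?_,
    homotopyEquivalent_of_retraction (h := Subtype.val ∘ f) 1 hf hval (hval.comp hf) (fun z => ?_)
      (funext fun z => Subtype.ext (hfz z z.2)) rfl⟩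
  · exact Finite.card_subtype_lt (x := x) (by simp)
  · by_cases hz : z = x
    · subst hz
      exact Or.inl (by simpa [hfx] using hadj)
    · exact Or.inr (hfz z hz).symm

end Reducible

/-! ### The doubled pentagon -/

section DoubledPentagon

theorem doubledPentagon_adj (i j : Fin 6) : doubledPentagon.Adj i j ↔
    (i, j) ∈ ({(0, 1), (1, 2), (2, 3), (3, 4), (4, 0), (3, 5), (5, 0), (1, 0), (2, 1), (3, 2),
      (4, 3), (0, 4), (5, 3), (0, 5)} : Finset (Fin 6 × Fin 6)) := by
  simp only [doubledPentagon, SimpleGraph.fromEdgeSet_adj, Set.mem_insert_iff,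
    Set.mem_singleton_iff]
  revert i j
  decide

instance : DecidableRel doubledPentagon.Adj := fun i j =>
  decidable_of_iff _ (doubledPentagon_adj i j).symm

/-- The map rotating the pentagon `0, 1, 2, 3, 4` by one step, and sending the second copy `5` of
`4` to `0`, moves points to adjacent points; its fifth iterate is the retraction onto the
pentagon. -/
theorem doubledPentagon_homotopyEquivalent :
    HomotopyEquivalent doubledPentagon (SimpleGraph.cycleGraph 5) := by
  refine homotopyEquivalent_of_retraction (f := ![0, 1, 2, 3, 4, 4]) (g := ![0, 1, 2, 3, 4])
    (h := ![1, 2, 3, 4, 0, 0]) 5 ?_ ?_ ?_ ?_ ?_ ?_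
  · unfold IsContinuous; decide
  · unfold IsContinuous; decide
  · unfold IsContinuous; decide
  · decide
  · decide
  · decide

theorem isReducible_of_iso_doubledPentagon {V : Type u} [Finite V] {G : SimpleGraph V}
    (e : G ≃g doubledPentagon) : IsReducible G := by
  refine ⟨ULift (Fin 5), inferInstance, (SimpleGraph.cycleGraph 5).comap Equiv.ulift, ?_,
    doubledPentagon_homotopyEquivalent.congr e.symm
      (SimpleGraph.Iso.comap Equiv.ulift (SimpleGraph.cycleGraph 5)).symm⟩
  simp [Nat.card_congr e.toEquiv]

end DoubledPentagon

/-! ### Invariance under isomorphism, and the two exceptional images -/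

section Invariants

variable {V : Type u} {W : Type v} {G : SimpleGraph V} {H : SimpleGraph W}

theorem HasDominatingClique.of_iso (e : G ≃g H) (hG : HasDominatingClique G) :
    HasDominatingClique H := by
  obtain ⟨S, hS, hdom⟩ := hG
  refine ⟨e '' S, ?_, fun y => ?_⟩
  · rintro _ ⟨a, ha, rfl⟩ _ ⟨b, hb, rfl⟩ hab
    exact e.map_adj_iff.2 (hS ha hb (ne_of_apply_ne e hab))
  · obtain ⟨s, hs, h⟩ := hdom (e.symm y)
    refine ⟨e s, ⟨s, hs, rfl⟩, h.imp (fun h => ?_) fun h => ?_⟩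
    · rw [← h, e.apply_symm_apply]
    · simpa using e.map_adj_iff.2 h

theorem HasNestedNbhds.of_iso (e : G ≃g H) (hG : HasNestedNbhds G) : HasNestedNbhds H := by
  obtain ⟨x, y, hxy, hsub⟩ := hG
  refine ⟨e x, e y, e.injective.ne hxy, fun z hz => ?_⟩
  obtain ⟨z, rfl⟩ := e.surjective z
  have := @hsub z
  simp only [closedNbhd, Set.mem_ofPred_eq, e.map_adj_iff, e.injective.eq_iff] at this hz ⊢
  exact this hz

/-- On a finite image the quantifier over cliques may range over finsets, so that it becomes
decidable. -/
theorem not_hasDominatingClique_of_finset [Fintype V]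
    (h : ∀ S : Finset V, (∀ a ∈ S, ∀ b ∈ S, a ≠ b → G.Adj a b) →
      ∃ x, ∀ s ∈ S, x ≠ s ∧ ¬ G.Adj x s) : ¬ HasDominatingClique G := by
  classical
  rintro ⟨S, hS, hdom⟩
  obtain ⟨x, hx⟩ := h S.toFinset fun a ha b hb =>
    hS (Set.mem_toFinset.1 ha) (Set.mem_toFinset.1 hb)
  obtain ⟨s, hs, hxs⟩ := hdom x
  have := hx s (Set.mem_toFinset.2 hs)
  tauto

theorem not_hasNestedNbhds_iff : ¬ HasNestedNbhds G ↔
    ∀ x y, x ≠ y → ∃ z, (z = x ∨ G.Adj z x) ∧ z ≠ y ∧ ¬ G.Adj z y := by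
  simp only [HasNestedNbhds, Set.not_subset, not_exists, not_and, closedNbhd]
  simp only [Set.mem_ofPred_eq, not_or, ne_eq]

theorem not_hasDominatingClique_cycleGraph_six :
    ¬ HasDominatingClique (SimpleGraph.cycleGraph 6) :=
  not_hasDominatingClique_of_finset (by decide)

theorem not_hasNestedNbhds_cycleGraph_six : ¬ HasNestedNbhds (SimpleGraph.cycleGraph 6) :=
  not_hasNestedNbhds_iff.2 (by decide)

theorem not_hasDominatingClique_doubledPentagon : ¬ HasDominatingClique doubledPentagon :=
  not_hasDominatingClique_of_finset (by decide)

theorem not_hasNestedNbhds_doubledPentagon : ¬ HasNestedNbhds doubledPentagon :=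
  not_hasNestedNbhds_iff.2 (by decide)

end Invariants

/-! ### Six-point images without dominating cliques and nested neighborhoods -/

section Classification

variable {V : Type u} {G : SimpleGraph V}

theorem exists_not_near_of_adj (hG : ¬ HasDominatingClique G) {s t : V} (hst : G.Adj s t) :
    ∃ x, (x ≠ s ∧ ¬ G.Adj x s) ∧ x ≠ t ∧ ¬ G.Adj x t := by
  by_contra! h
  refine hG ⟨{s, t}, ?_, fun x => ?_⟩
  · simpa [SimpleGraph.isClique_pair] using fun _ => hst
  · have := h x
    simp only [Set.mem_insert_iff, Set.mem_singleton_iff, exists_eq_or_imp, exists_eq_left]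
    tauto

theorem exists_not_near (hG : ¬ HasDominatingClique G) (s : V) : ∃ x, x ≠ s ∧ ¬ G.Adj x s := by
  by_contra! h
  refine hG ⟨{s}, by simp, fun x => ⟨s, rfl, ?_⟩⟩
  have := h x
  tauto

/-- Four distinct points of a six-point set are completed to an enumeration. -/
theorem exists_completion [Finite V] (hV : Nat.card V = 6) {v a b c : V}
    (h : [v, a, b, c].Nodup) :
    ∃ d e, [v, a, b, c, d, e].Nodup ∧
      ∀ x, x = v ∨ x = a ∨ x = b ∨ x = c ∨ x = d ∨ x = e := by
  classical
  have := Fintype.ofFinite V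
  have hc : (({v, a, b, c} : Finset V)ᶜ).card = 2 := by
    rw [Finset.card_compl, ← Nat.card_eq_fintype_card, hV,
      show ({v, a, b, c} : Finset V) = [v, a, b, c].toFinset by simp,
      List.toFinset_card_of_nodup h]
    rfl
  obtain ⟨d, e, hde, hs⟩ := Finset.card_eq_two.1 hc
  have hmem : ∀ x, ¬ (x = v ∨ x = a ∨ x = b ∨ x = c) ↔ x = d ∨ x = e := fun x => by
    simpa using Finset.ext_iff.1 hs x
  have hd := (hmem d).2 (Or.inl rfl)
  have he := (hmem e).2 (Or.inr rfl)
  refine ⟨d, e, ?_, fun x => ?_⟩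
  · simp only [List.nodup_cons, List.mem_cons, List.not_mem_nil, or_false, not_or] at h ⊢
    grind
  · have := hmem x
    tauto

/-- An enumeration of the points under which the adjacencies match those of `H` is an
isomorphism. -/
theorem nonempty_iso_of_enumeration {n : ℕ} {H : SimpleGraph (Fin n)} (f : Fin n → V)
    (hf : Function.Bijective f) (hadj : ∀ i j, i < j → (G.Adj (f i) (f j) ↔ H.Adj i j)) :
    Nonempty (G ≃g H) := by
  refine ⟨(RelIso.mk (Equiv.ofBijective f hf) fun {i j} => ?_ : H ≃g G).symm⟩
  rcases lt_trichotomy i j with h | rfl | h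
  · exact hadj i j h
  · simp
  · exact (G.adj_comm _ _).trans ((hadj j i h).trans (H.adj_comm _ _))

/-- Each point has a second neighbor: a point with a single neighbor has its closed neighborhood
contained in that of the neighbor. -/
theorem exists_adj_ne (hnest : ¬ HasNestedNbhds G) {x y : V} (hxy : G.Adj x y) :
    ∃ z, z ≠ y ∧ G.Adj x z := by
  rw [not_hasNestedNbhds_iff] at hnest
  obtain ⟨z, h, hz, hzy⟩ := hnest x y hxy.ne
  rcases h with rfl | h
  · exact absurd hxy hzy
  · exact ⟨z, hz, h.symm⟩

theorem exists_adj [Finite V] (hV : Nat.card V = 6) (hconn : G.Connected) (x : V) :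
    ∃ y, G.Adj x y := by
  have : Nontrivial V := Finite.one_lt_card_iff_nontrivial.1 (by omega)
  exact hconn.preconnected.exists_adj_of_nontrivial x

/-- No closed neighborhood misses just one point `e`: the edge from `v` to a neighbor of `e` would
be dominating. -/
theorem not_forall_adj_of_not_hasDominatingClique [Finite V] (hV : Nat.card V = 6)
    (hconn : G.Connected) (hdom : ¬ HasDominatingClique G) (v e : V) :
    ¬ ∀ x, x = v ∨ x = e ∨ G.Adj v x := by
  intro h
  obtain ⟨x, hxv, hx⟩ := exists_not_near hdom v
  obtain ⟨w, hew⟩ := exists_adj hV hconn e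
  have hvw : G.Adj v w := by
    have := h x
    have := h w
    grind [SimpleGraph.adj_comm, SimpleGraph.irrefl]
  obtain ⟨y, ⟨hyv, hy⟩, hyw, hy'⟩ := exists_not_near_of_adj hdom hvw
  have := h y
  grind [SimpleGraph.adj_comm]

/-- Here `v` has the neighbors `a, b, c`, while `d` and `e` are the points outside `N(v)`, with
`d` joined to `a, b` and `e` joined to `c`. The pentagon is `v, c, e, d, a`, and `b` doubles `a`. -/
theorem iso_doubledPentagon_of_partition (hdom : ¬ HasDominatingClique G)
    (hnest : ¬ HasNestedNbhds G) {v a b c d e : V}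
    (hnd : [v, a, b, c, d, e].Nodup)
    (hcov : ∀ x, x = v ∨ x = a ∨ x = b ∨ x = c ∨ x = d ∨ x = e)
    (hva : G.Adj v a) (hvb : G.Adj v b) (hvc : G.Adj v c) (had : G.Adj a d) (hbd : G.Adj b d)
    (hce : G.Adj c e) (hvd : ¬ G.Adj v d) (hve : ¬ G.Adj v e) (hae : ¬ G.Adj a e)
    (hbe : ¬ G.Adj b e) (hcd : ¬ G.Adj c d) : Nonempty (G ≃g doubledPentagon) := by
  have hde : G.Adj d e := by
    obtain ⟨x, hx, hex⟩ := exists_adj_ne hnest hce.symm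
    have := hcov x
    grind [SimpleGraph.adj_comm, SimpleGraph.irrefl]
  have hac : ¬ G.Adj a c := fun h => by
    obtain ⟨x, hx⟩ := exists_not_near_of_adj hdom had
    have := hcov x
    grind [SimpleGraph.adj_comm]
  have hbc : ¬ G.Adj b c := fun h => by
    obtain ⟨x, hx⟩ := exists_not_near_of_adj hdom hbd
    have := hcov x
    grind [SimpleGraph.adj_comm]
  simp only [List.nodup_cons, List.mem_cons, List.not_mem_nil, or_false, not_or] at hnd
  have hab : ¬ G.Adj a b := fun h => by
    obtain ⟨x, hx⟩ := not_hasNestedNbhds_iff.1 hnest a b h.ne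
    have := hcov x
    grind [SimpleGraph.adj_comm]
  refine nonempty_iso_of_enumeration ![v, c, e, d, a, b] ⟨?_, fun x => ?_⟩ ?_
  · rw [← List.nodup_ofFn]
    simp
    grind
  · rcases hcov x with rfl | rfl | rfl | rfl | rfl | rfl
    exacts [⟨0, rfl⟩, ⟨4, rfl⟩, ⟨5, rfl⟩, ⟨1, rfl⟩, ⟨3, rfl⟩, ⟨2, rfl⟩]
  · simp [Fin.forall_fin_succ, doubledPentagon_adj, *, G.adj_comm c a, G.adj_comm c b,
      G.adj_comm e a, G.adj_comm e b, G.adj_comm d a, G.adj_comm d b, G.adj_comm e d]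

/-- A point `v` with three neighbors forces the doubled pentagon. Each neighbor of `v` is joined to
exactly one of the two points `d, e` outside `N(v)`: to one since `N(a)` is not contained in `N(v)`,
and to only one since the edge `va` is not dominating. -/
theorem iso_doubledPentagon_of_three_adj [Finite V] (hV : Nat.card V = 6) (hconn : G.Connected)
    (hdom : ¬ HasDominatingClique G) (hnest : ¬ HasNestedNbhds G) {v a b c : V}
    (hab : a ≠ b) (hac : a ≠ c) (hbc : b ≠ c) (ha : G.Adj v a) (hb : G.Adj v b)
    (hc : G.Adj v c) : Nonempty (G ≃g doubledPentagon) := by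
  classical
  obtain ⟨d, e, hnd, hcov⟩ := exists_completion hV (v := v) (a := a) (b := b) (c := c) (by
    simp [ha.ne, hb.ne, hc.ne, hab, hac, hbc])
  have hvd : ¬ G.Adj v d := fun h =>
    not_forall_adj_of_not_hasDominatingClique hV hconn hdom v e fun x => by
      have := hcov x
      grind
  have hve : ¬ G.Adj v e := fun h =>
    not_forall_adj_of_not_hasDominatingClique hV hconn hdom v d fun x => by
      have := hcov x
      grind
  have one : ∀ x, G.Adj v x → (G.Adj x d ∧ ¬ G.Adj x e) ∨ (¬ G.Adj x d ∧ G.Adj x e) := by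
    intro x hx
    obtain ⟨y, hy⟩ := not_hasNestedNbhds_iff.1 hnest x v hx.ne'
    obtain ⟨z, hz⟩ := exists_not_near_of_adj hdom hx
    have := hcov y
    have := hcov z
    grind [SimpleGraph.adj_comm]
  -- If all neighbors of `v` missed `q`, the only possible neighbor of `q` would be `p`.
  have two : ∀ p q, p ≠ q → (∀ x, x = v ∨ G.Adj v x ∨ x = p ∨ x = q) → ¬ G.Adj v q →
      ¬ ∀ x, G.Adj v x → ¬ G.Adj x q := by
    intro p q hpq hcov' hvq h
    obtain ⟨y, hy⟩ := exists_adj hV hconn q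
    obtain ⟨z, hzy, hz⟩ := exists_adj_ne hnest hy
    have := hcov' y
    have := hcov' z
    grind [SimpleGraph.adj_comm, SimpleGraph.irrefl]
  have hcov' : ∀ x, x = v ∨ G.Adj v x ∨ x = d ∨ x = e := fun x => by
    have := hcov x
    grind
  have hvx : ∀ x, G.Adj v x → x = a ∨ x = b ∨ x = c := fun x hx => by
    have := hcov x
    grind [SimpleGraph.irrefl]
  have main := @iso_doubledPentagon_of_partition V G hdom hnest
  have hde : d ≠ e := by
    simp only [List.nodup_cons, List.mem_cons, List.not_mem_nil, or_false, not_or] at hnd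
    tauto
  have two_e := two d e hde hcov' hve
  have two_d := two e d hde.symm (fun x => by have := hcov' x; tauto) hvd
  have nodup : ∀ {x y z p q : V}, [v, x, y, z, p, q].Perm [v, a, b, c, d, e] →
      [v, x, y, z, p, q].Nodup := fun h => h.nodup_iff.2 hnd
  have cov : ∀ {x y z p q : V}, [v, x, y, z, p, q].Perm [v, a, b, c, d, e] →
      ∀ w, w = v ∨ w = x ∨ w = y ∨ w = z ∨ w = p ∨ w = q := fun h w => by
    have := h.mem_iff (a := w)
    simp only [List.mem_cons, List.not_mem_nil, or_false] at this
    exact this.2 (hcov w)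
  rcases one a ha with ⟨a1, a2⟩ | ⟨a1, a2⟩ <;> rcases one b hb with ⟨b1, b2⟩ | ⟨b1, b2⟩ <;>
    rcases one c hc with ⟨c1, c2⟩ | ⟨c1, c2⟩
  · exact (two_e fun x hx => by rcases hvx x hx with rfl | rfl | rfl <;> assumption).elim
  · exact main hnd hcov ha hb hc a1 b1 c2 hvd hve a2 b2 c1
  · have h : [v, a, c, b, d, e].Perm [v, a, b, c, d, e] :=
      List.perm_iff_count.2 fun w => by simp only [List.count_cons]; ring
    exact main (nodup h) (cov h) ha hc hb a1 c1 b2 hvd hve a2 c2 b1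
  · have h : [v, b, c, a, e, d].Perm [v, a, b, c, d, e] :=
      List.perm_iff_count.2 fun w => by simp only [List.count_cons]; ring
    exact main (nodup h) (cov h) hb hc ha b2 c2 a1 hve hvd b1 c1 a2
  · have h : [v, b, c, a, d, e].Perm [v, a, b, c, d, e] :=
      List.perm_iff_count.2 fun w => by simp only [List.count_cons]; ring
    exact main (nodup h) (cov h) hb hc ha b1 c1 a2 hvd hve b2 c2 a1
  · have h : [v, a, c, b, e, d].Perm [v, a, b, c, d, e] :=
      List.perm_iff_count.2 fun w => by simp only [List.count_cons]; ring
    exact main (nodup h) (cov h) ha hc hb a2 c2 b1 hve hvd a1 c1 b2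
  · have h : [v, a, b, c, e, d].Perm [v, a, b, c, d, e] :=
      List.perm_iff_count.2 fun w => by simp only [List.count_cons]; ring
    exact main (nodup h) (cov h) ha hb hc a2 b2 c1 hve hvd a1 b1 c2
  · exact (two_d fun x hx => by rcases hvx x hx with rfl | rfl | rfl <;> assumption).elim

/-- If no point has three neighbors, then every point has exactly two, and the image is a cycle:
extend `v` to a path `c, a, v, b, d` and close it up by the sixth point. -/
theorem iso_cycleGraph_six_of_adj_le_two [Finite V] (hV : Nat.card V = 6) (hconn : G.Connected)
    (hnest : ¬ HasNestedNbhds G)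
    (hdeg : ∀ v a b c, G.Adj v a → G.Adj v b → G.Adj v c → a = b ∨ a = c ∨ b = c) :
    Nonempty (G ≃g SimpleGraph.cycleGraph 6) := by
  -- Two neighbors exhaust the neighbors of a point.
  have full : ∀ {x y z}, G.Adj x y → G.Adj x z → y ≠ z → ∀ w, G.Adj w x → w = y ∨ w = z :=
    fun hy hz hyz w hw => by
      have := hdeg _ _ _ _ hy hz hw.symm
      tauto
  obtain ⟨v⟩ := hconn.nonempty
  obtain ⟨a, hva⟩ := exists_adj hV hconn v
  obtain ⟨b, hba, hvb⟩ := exists_adj_ne hnest hva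
  have fv := full hva hvb hba.symm
  have hab : ¬ G.Adj a b := fun h => by
    obtain ⟨x, hx⟩ := not_hasNestedNbhds_iff.1 hnest v a hva.ne
    have := fv x
    grind [SimpleGraph.adj_comm]
  obtain ⟨c, hcv, hac⟩ := exists_adj_ne hnest hva.symm
  obtain ⟨d, hdv, hbd⟩ := exists_adj_ne hnest hvb.symm
  have fa := full hva.symm hac hcv.symm
  have fb := full hvb.symm hbd hdv.symm
  have hcb : c ≠ b := fun h => hab (h ▸ hac)
  have hda : d ≠ a := fun h => hab (h ▸ hbd).symm
  obtain ⟨p, q, hnd, hcov⟩ := exists_completion hV (v := v) (a := a) (b := b) (c := c) (by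
    simp [hva.ne, hvb.ne, hcv.symm, hba.symm, hac.ne, hcb.symm])
  simp only [List.nodup_cons, List.mem_cons, List.not_mem_nil, or_false, not_or] at hnd
  have hcd : c ≠ d := by
    rintro rfl
    -- The remaining points `p, q` would have no neighbors in the 4-cycle `v, a, c, b`.
    have fc := full hac.symm hbd.symm hba.symm
    obtain ⟨y, hy⟩ := exists_adj hV hconn p
    obtain ⟨z, hzy, hz⟩ := exists_adj_ne hnest hy
    have := hcov y
    have := hcov z
    have := fv p
    have := fa p
    have := fb p
    have := fc p
    grind [SimpleGraph.adj_comm, SimpleGraph.irrefl]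
  obtain ⟨e, hnd, hcov⟩ : ∃ e, [v, a, b, c, d, e].Nodup ∧
      ∀ x, x = v ∨ x = a ∨ x = b ∨ x = c ∨ x = d ∨ x = e := by
    simp only [List.nodup_cons, List.mem_cons, List.not_mem_nil, or_false, not_or]
    have := hbd.ne
    rcases hcov d with h | h | h | h | h | h
    · exact absurd h hdv
    · exact absurd h hda
    · exact absurd h.symm hbd.ne
    · exact absurd h.symm hcd
    · exact ⟨q, by grind, fun x => by have := hcov x; grind⟩
    · exact ⟨p, by grind, fun x => by have := hcov x; grind⟩
  simp only [List.nodup_cons, List.mem_cons, List.not_mem_nil, or_false, not_or] at hnd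
  -- Otherwise `v, a, c, d, b` would be a closed 5-cycle and `e` isolated.
  have hcd' : ¬ G.Adj c d := fun h => by
    have fc := full hac.symm h (Ne.symm hda)
    have fd := full hbd.symm h.symm (Ne.symm hcb)
    obtain ⟨y, hy⟩ := exists_adj hV hconn e
    have := hcov y
    have := fv e
    have := fa e
    have := fb e
    have := fc e
    have := fd e
    grind [SimpleGraph.adj_comm, SimpleGraph.irrefl]
  have hce : G.Adj c e := by
    obtain ⟨y, hya, hy⟩ := exists_adj_ne hnest hac.symm
    have := hcov y
    have := fv c
    have := fb c
    grind [SimpleGraph.adj_comm, SimpleGraph.irrefl]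
  have hde : G.Adj d e := by
    obtain ⟨y, hyb, hy⟩ := exists_adj_ne hnest hbd.symm
    have := hcov y
    have := fv d
    have := fa d
    grind [SimpleGraph.adj_comm, SimpleGraph.irrefl]
  have hvc : ¬ G.Adj v c := fun h => by grind [SimpleGraph.adj_comm]
  have hvd : ¬ G.Adj v d := fun h => by grind [SimpleGraph.adj_comm]
  have hve : ¬ G.Adj v e := fun h => by grind [SimpleGraph.adj_comm]
  have had : ¬ G.Adj a d := fun h => by grind [SimpleGraph.adj_comm]
  have hae : ¬ G.Adj a e := fun h => by grind [SimpleGraph.adj_comm]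
  have hbc : ¬ G.Adj b c := fun h => by grind [SimpleGraph.adj_comm]
  have hbe : ¬ G.Adj b e := fun h => by grind [SimpleGraph.adj_comm]
  have hadj : ∀ i j : Fin 6, (SimpleGraph.cycleGraph 6).Adj i j ↔ i = j + 1 ∨ j = i + 1 := by
    decide
  refine nonempty_iso_of_enumeration ![v, a, c, e, d, b] ⟨?_, fun x => ?_⟩ ?_
  · rw [← List.nodup_ofFn]
    simp
    grind
  · rcases hcov x with rfl | rfl | rfl | rfl | rfl | rfl
    exacts [⟨0, rfl⟩, ⟨1, rfl⟩, ⟨5, rfl⟩, ⟨2, rfl⟩, ⟨4, rfl⟩, ⟨3, rfl⟩]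
  · simp [Fin.forall_fin_succ, *, G.adj_comm c b, G.adj_comm e b, G.adj_comm d b,
      G.adj_comm e d]

theorem iso_cycleGraph_six_or_doubledPentagon [Finite V] (hV : Nat.card V = 6)
    (hconn : G.Connected) (hdom : ¬ HasDominatingClique G) (hnest : ¬ HasNestedNbhds G) :
    Nonempty (G ≃g SimpleGraph.cycleGraph 6) ∨ Nonempty (G ≃g doubledPentagon) := by
  by_cases h : ∀ v a b c, G.Adj v a → G.Adj v b → G.Adj v c → a = b ∨ a = c ∨ b = c
  · exact Or.inl (iso_cycleGraph_six_of_adj_le_two hV hconn hnest h)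
  · push Not at h
    obtain ⟨v, a, b, c, ha, hb, hc, hab, hac, hbc⟩ := h
    exact Or.inr (iso_doubledPentagon_of_three_adj hV hconn hdom hnest hab hac hbc ha hb hc)

end Classification

end DigitalImage

theorem theorem4p9 {V : Type u} [Finite V] (G : SimpleGraph V)
    (hconn : G.Connected) (hcard : Nat.card V = 6) :
    (DigitalImage.IsIrreducible G →
      DigitalImage.HomotopyEquivalent G (SimpleGraph.cycleGraph 6) ∧
        Nonempty (G ≃g SimpleGraph.cycleGraph 6)) ∧
    ((¬ DigitalImage.HasDominatingClique G ∧ ¬ DigitalImage.HasNestedNbhds G) ↔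
      Nonempty (G ≃g SimpleGraph.cycleGraph 6) ∨
        Nonempty (G ≃g DigitalImage.doubledPentagon)) ∧
    DigitalImage.HomotopyEquivalent DigitalImage.doubledPentagon (SimpleGraph.cycleGraph 5) := by
  refine ⟨fun hirr => ?_, ⟨fun h =>
    DigitalImage.iso_cycleGraph_six_or_doubledPentagon hcard hconn h.1 h.2, ?_⟩,
    DigitalImage.doubledPentagon_homotopyEquivalent⟩
  · have hiso : Nonempty (G ≃g SimpleGraph.cycleGraph 6) :=
      (DigitalImage.iso_cycleGraph_six_or_doubledPentagon hcard hconn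
        (fun h => hirr (h.isReducible (by omega))) (fun h => hirr h.isReducible)).resolve_right
        fun ⟨e⟩ => hirr (DigitalImage.isReducible_of_iso_doubledPentagon e)
    exact ⟨hiso.elim DigitalImage.homotopyEquivalent_of_iso, hiso⟩
  · rintro (⟨⟨e⟩⟩ | ⟨⟨e⟩⟩)
    · exact ⟨fun h => DigitalImage.not_hasDominatingClique_cycleGraph_six (h.of_iso e),
        fun h => DigitalImage.not_hasNestedNbhds_cycleGraph_six (h.of_iso e)⟩
    · exact ⟨fun h => DigitalImage.not_hasDominatingClique_doubledPentagon (h.of_iso e),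
        fun h => DigitalImage.not_hasNestedNbhds_doubledPentagon (h.of_iso e)⟩
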